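/- Let $n\ge 2$. There exists a compact set $E\subset\mathbb{R}^n$ of Hausdorff dimension exactly $n/2$ with the following properties: 1. the distance set $D(E)=\{|x-y| : x,y\in E\}\subset\mathbb{R}$ has Lebesgue measure zero; 2. $|x-y|$ is irrational for all $x,y\in E$ with $x\ne y$; 3. no three distinct points of $E$ are collinear; 4. every nonzero distance is realised at most once by $E$: if $x,y,z,w\in E$, $x\neq y$, $z\neq w$ and $|x-y|=|z-w|$, then $\{x,y\}=\{z,w\}$; 5. every direction is realised at most once by $E$: if $x,y,z,w\in E$, $x\neq y$, $z\neq w$ and $y-x$ is parallel to $w-z$ (that is, these two vectors span the same line through the origin), then $\{x,y\}=\{z,w\}$. -/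

import Mathlib

/-- The distance set `D(E) = {|x - y| : x, y ∈ E}` of a set `E` in a metric space. -/
def distanceSet {X : Type*} [PseudoMetricSpace X] (E : Set X) : Set ℝ :=
  {r | ∃ x ∈ E, ∃ y ∈ E, dist x y = r}

/-- Every (nonzero) distance is realised at most once by `E`: the distance determines the
unordered pair of distinct points of `E` that realises it. -/
def DistancesRealisedAtMostOnce {X : Type*} [PseudoMetricSpace X] (E : Set X) : Prop :=
  ∀ x ∈ E, ∀ y ∈ E, ∀ z ∈ E, ∀ w ∈ E, x ≠ y → z ≠ w →
    dist x y = dist z w → s(x, y) = s(z, w)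

/-- Every direction is realised at most once by `E`: the direction of the line through two distinct
points of `E`, that is, the one-dimensional subspace spanned by their difference (so that a vector
and its negative have the same direction), determines the unordered pair of points. -/
def DirectionsRealisedAtMostOnce {V : Type*} [AddCommGroup V] [Module ℝ V] (E : Set V) : Prop :=
  ∀ x ∈ E, ∀ y ∈ E, ∀ z ∈ E, ∀ w ∈ E, x ≠ y → z ≠ w →
    Submodule.span ℝ {y - x} = Submodule.span ℝ {w - z} → s(x, y) = s(z, w)

open Filter Topology MeasureTheory TopologicalSpace
open scoped ENNReal NNReal

/-! The set is a Cantor set. The balls of generation k + 1 have centres in the lattice of mesh 1 /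
N_k, translated by σ_k(c) / N_k ^ 2, where c is the centre of the parent ball. Their radius is 1 /
((k + 1) N_k ^ 2), which is o(N_k ^ (-2)).

Every forbidden relation has the form G(u) = 0, where G takes values in ℤ / N_k ^ 2 at lattice
points: a squared distance minus a rational square, a difference of two squared distances, or a 2 ×
2 minor of two difference vectors. If a is the tuple of lattice points underlying u, then N_k ^ 2
G(a) is an integer, and to first order it is minus the derivative of G at u in the direction of the
translations. The fields σ_k run infinitely often through all fields that are constant on a basic
open set and zero outside. So one point can be translated alone, by a vector for which the limit
lies strictly between -1 and 0, unless G is stationary in that point. This is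
`hasDerivAt_eq_zero_of_apply_eq_zero`; a nonzero derivative then excludes each relation.

The zero field also recurs. At those generations all squared distances lie very close to ℤ / N_k ^
2, which makes the distance set null.

For the dimension (`dimH_latticeCantor`), there are at most Q_k ^ n balls of radius 1 / D_k, and the
branching numbers grow so fast that D_k is Q_k ^ 2 up to an arbitrarily small loss in the exponent.
-/

/-! ### Numerical parameters of the construction -/

/-- The number of children per coordinate in a generation `k` with shift bound `b` and inverse
radius `D`. -/
def branchingAux (n b k D : ℕ) : ℕ := k.factorial * (1 + b) * ((k + 1) * (4 * n * D) ^ 2) ^ k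

/-- The inverse radius of the balls of generation `k`. -/
def invRadius (n : ℕ) (B : ℕ → ℕ) : ℕ → ℕ
  | 0 => 1
  | k + 1 => (k + 1) *
      (4 * n * invRadius n B k * branchingAux n (B k) k (invRadius n B k)) ^ 2

/-- The number of children per coordinate of a ball of generation `k`. -/
def branching (n : ℕ) (B : ℕ → ℕ) (k : ℕ) : ℕ := branchingAux n (B k) k (invRadius n B k)

/-- The children of a ball of generation `k` lie near the lattice of mesh `1 / mesh n B k`. -/
def mesh (n : ℕ) (B : ℕ → ℕ) (k : ℕ) : ℕ := 4 * n * invRadius n B k * branching n B k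

/-- The number of balls of generation `k` per coordinate. -/
def leafCount (n : ℕ) (B : ℕ → ℕ) (k : ℕ) : ℕ := ∏ j ∈ Finset.range k, branching n B j

section Parameters

variable {n : ℕ} {B : ℕ → ℕ}

lemma invRadius_succ (k : ℕ) : invRadius n B (k + 1) = (k + 1) * mesh n B k ^ 2 := rfl

lemma leafCount_succ (k : ℕ) : leafCount n B (k + 1) = leafCount n B k * branching n B k :=
  Finset.prod_range_succ _ _

lemma branchingAux_pos (hn : 0 < n) {b k D : ℕ} (hD : 0 < D) : 0 < branchingAux n b k D := by
  unfold branchingAux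
  have := k.factorial_pos
  positivity

lemma invRadius_pos (hn : 0 < n) (k : ℕ) : 0 < invRadius n B k := by
  induction k with
  | zero => simp [invRadius]
  | succ k ih =>
    have := branchingAux_pos hn (b := B k) (k := k) ih
    rw [invRadius]
    positivity

lemma branching_pos (hn : 0 < n) (k : ℕ) : 0 < branching n B k :=
  branchingAux_pos hn (invRadius_pos hn k)

lemma mesh_pos (hn : 0 < n) (k : ℕ) : 0 < mesh n B k := by
  have := branching_pos (B := B) hn k
  have := invRadius_pos (B := B) hn k
  unfold mesh
  positivity

lemma leafCount_pos (hn : 0 < n) (k : ℕ) : 0 < leafCount n B k :=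
  Finset.prod_pos fun j _ => branching_pos hn j

/-- Any fixed denominator divides all sufficiently late meshes; this is what excludes rational
distances. -/
lemma factorial_dvd_mesh (k : ℕ) : k.factorial ∣ mesh n B k := by
  unfold mesh branching branchingAux
  exact Dvd.dvd.mul_left (Dvd.dvd.mul_right (Dvd.intro _ rfl) _) _

lemma one_add_le_branching (hn : 0 < n) (k : ℕ) : 1 + B k ≤ branching n B k := by
  have h1 := k.factorial_pos
  have h2 := invRadius_pos (B := B) hn k
  have h3 : 0 < k.factorial * ((k + 1) * (4 * n * invRadius n B k) ^ 2) ^ k := by positivity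
  calc 1 + B k ≤ (1 + B k) * (k.factorial * ((k + 1) * (4 * n * invRadius n B k) ^ 2) ^ k) :=
        Nat.le_mul_of_pos_right _ h3
    _ = branching n B k := by unfold branching branchingAux; ring

lemma pow_le_branching (k : ℕ) :
    ((k + 1) * (4 * n * invRadius n B k) ^ 2) ^ k ≤ branching n B k := by
  have h1 := k.factorial_pos
  exact Nat.le_mul_of_pos_left _ (by positivity)

lemma four_mul_invRadius_le_mesh (hn : 0 < n) (k : ℕ) : 4 * invRadius n B k ≤ mesh n B k := by
  have h1 := branching_pos (B := B) hn k
  calc 4 * invRadius n B k ≤ 4 * invRadius n B k * (n * branching n B k) :=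
        Nat.le_mul_of_pos_right _ (by positivity)
    _ = mesh n B k := by unfold mesh; ring

lemma mesh_sq_le_invRadius (k : ℕ) : mesh n B k ^ 2 ≤ invRadius n B (k + 1) := by
  rw [invRadius_succ]
  exact Nat.le_mul_of_pos_left _ k.succ_pos

lemma two_mul_invRadius_le (hn : 0 < n) (k : ℕ) : 2 * invRadius n B k ≤ invRadius n B (k + 1) := by
  have h1 := four_mul_invRadius_le_mesh (B := B) hn k
  have h2 := mesh_sq_le_invRadius (n := n) (B := B) k
  have h3 := mesh_pos (B := B) hn k
  nlinarith

lemma monotone_invRadius (hn : 0 < n) : Monotone (invRadius n B) :=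
  monotone_nat_of_le_succ fun k => by
    have := two_mul_invRadius_le (B := B) hn k
    lia

lemma le_invRadius (hn : 0 < n) (k : ℕ) : k ≤ invRadius n B k := by
  cases k with
  | zero => simp
  | succ k =>
    rw [invRadius_succ]
    have := mesh_pos (B := B) hn k
    exact Nat.le_mul_of_pos_right _ (by positivity)

/-- This keeps the sum of the (n/2)-th powers of the radii at most 1 in every generation, hence the
upper bound for the dimension. -/
lemma leafCount_sq_le_invRadius (hn : 0 < n) (k : ℕ) :
    leafCount n B k ^ 2 ≤ invRadius n B k := by
  induction k with
  | zero => simp [leafCount, invRadius]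
  | succ k ih =>
    have hD := invRadius_pos (B := B) hn k
    calc leafCount n B (k + 1) ^ 2 = leafCount n B k ^ 2 * branching n B k ^ 2 := by
          rw [leafCount_succ, mul_pow]
      _ ≤ (((4 * n) ^ 2) * invRadius n B k ^ 2) * branching n B k ^ 2 := by
          gcongr
          calc leafCount n B k ^ 2 ≤ invRadius n B k := ih
            _ ≤ invRadius n B k ^ 2 := Nat.le_self_pow two_ne_zero _
            _ ≤ _ := Nat.le_mul_of_pos_left _ (by positivity)
      _ = mesh n B k ^ 2 := by unfold mesh; ring
      _ ≤ _ := mesh_sq_le_invRadius k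

/-- A converse to `leafCount_sq_le_invRadius` with a loss in the exponent that vanishes as m grows.
One has D_{j+1} = A M_j ^ 2, where A depends only on j, n and D_j, and M_j was chosen to be at least
A ^ j. The finitely many k ≤ m go into the constant. -/
lemma invRadius_pow_le (hn : 0 < n) (m k : ℕ) :
    invRadius n B k ^ m ≤ invRadius n B m ^ m * leafCount n B k ^ (2 * m + 1) := by
  have hDm := invRadius_pos (B := B) hn m
  have hQ := leafCount_pos (B := B) hn k
  rcases le_or_gt k m with hkm | hkm
  · calc invRadius n B k ^ m ≤ invRadius n B m ^ m :=
          Nat.pow_le_pow_left (monotone_invRadius hn hkm) m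
      _ ≤ _ := Nat.le_mul_of_pos_right _ (by positivity)
  · obtain ⟨j, rfl⟩ : ∃ j, k = j + 1 := ⟨k - 1, by lia⟩
    have hDj := invRadius_pos (B := B) hn j
    set A := (j + 1) * (4 * n * invRadius n B j) ^ 2 with hA
    have hA1 : 0 < A := by positivity
    have hAM : A ^ m ≤ branching n B j :=
      (Nat.pow_le_pow_right hA1 (by lia)).trans (pow_le_branching j)
    have hMQ : branching n B j ≤ leafCount n B (j + 1) := by
      rw [leafCount_succ]
      exact Nat.le_mul_of_pos_left _ (leafCount_pos hn j)
    calc invRadius n B (j + 1) ^ m = A ^ m * branching n B j ^ (2 * m) := by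
          have e : invRadius n B (j + 1) = A * branching n B j ^ 2 := by
            rw [invRadius_succ, mesh, hA]; ring
          rw [e, mul_pow, ← pow_mul]
      _ ≤ branching n B j * branching n B j ^ (2 * m) := by gcongr
      _ = branching n B j ^ (2 * m + 1) := by ring
      _ ≤ leafCount n B (j + 1) ^ (2 * m + 1) := by gcongr
      _ ≤ _ := Nat.le_mul_of_pos_left _ (by positivity)

end Parameters

/-! ### The Cantor set -/

lemma EuclideanSpace.norm_le_card_mul {n : ℕ} (x : EuclideanSpace ℝ (Fin n)) {c : ℝ}
    (h : ∀ i, |x i| ≤ c) : ‖x‖ ≤ n * c := by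
  rcases Nat.eq_zero_or_pos n with rfl | hn
  · simp [Subsingleton.elim x 0]
  have hc : 0 ≤ c := (abs_nonneg _).trans (h ⟨0, hn⟩)
  have h1 : (1 : ℝ) ≤ n := by exact_mod_cast hn
  refine (abs_le_of_sq_le_sq' ?_ (by positivity)).2
  rw [EuclideanSpace.real_norm_sq_eq]
  calc ∑ i, x i ^ 2 ≤ ∑ _i : Fin n, c ^ 2 :=
        Finset.sum_le_sum fun i _ => sq_le_sq' (abs_le.1 (h i)).1 (abs_le.1 (h i)).2
    _ = n * c ^ 2 := by simp
    _ ≤ (n * c) ^ 2 := by nlinarith [sq_nonneg c]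

/-- The centre of the child with digits `d` of a ball with centre `c`: a point of the lattice of
mesh `1 / N`, translated by `v / N ^ 2`. -/
noncomputable def childCenter {n : ℕ} (N : ℕ) (v c : EuclideanSpace ℝ (Fin n)) (d : Fin n → ℕ) :
    EuclideanSpace ℝ (Fin n) :=
  WithLp.toLp 2 fun i => ((⌈N * c i⌉ : ℝ) + d i) / N + v i / N ^ 2

open Classical in
/-- The centres of the balls of generation `k`. -/
noncomputable def centers {n : ℕ} (B : ℕ → ℕ)
    (σ : ℕ → EuclideanSpace ℝ (Fin n) → EuclideanSpace ℝ (Fin n)) :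
    ℕ → Finset (EuclideanSpace ℝ (Fin n))
  | 0 => {0}
  | k + 1 => (centers B σ k).biUnion fun c =>
      (Fintype.piFinset fun _ : Fin n => Finset.range (branching n B k)).image
        (childCenter (mesh n B k) (σ k c) c)

/-- The Cantor set of the points that lie in a ball of each generation. -/
def latticeCantor {n : ℕ} (B : ℕ → ℕ)
    (σ : ℕ → EuclideanSpace ℝ (Fin n) → EuclideanSpace ℝ (Fin n)) :
    Set (EuclideanSpace ℝ (Fin n)) :=
  ⋂ k, ⋃ c ∈ centers B σ k, Metric.closedBall c (invRadius n B k : ℝ)⁻¹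

section Cantor

variable {n : ℕ} {B : ℕ → ℕ} {σ : ℕ → EuclideanSpace ℝ (Fin n) → EuclideanSpace ℝ (Fin n)}

lemma isCompact_latticeCantor : IsCompact (latticeCantor B σ) :=
  have h k := (centers B σ k).isCompact_biUnion fun c _ =>
    isCompact_closedBall c (invRadius n B k : ℝ)⁻¹
  (h 0).of_isClosed_subset (isClosed_iInter fun k => (h k).isClosed) (Set.iInter_subset _ 0)

lemma mem_latticeCantor {x : EuclideanSpace ℝ (Fin n)} :
    x ∈ latticeCantor B σ ↔ ∀ k, ∃ c ∈ centers B σ k, dist x c ≤ (invRadius n B k : ℝ)⁻¹ := by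
  simp [latticeCantor]

lemma mem_centers_succ {k : ℕ} {x : EuclideanSpace ℝ (Fin n)} :
    x ∈ centers B σ (k + 1) ↔ ∃ c ∈ centers B σ k, ∃ d : Fin n → ℕ,
      (∀ i, d i < branching n B k) ∧ childCenter (mesh n B k) (σ k c) c d = x := by
  simp [centers]

lemma card_centers_le (k : ℕ) : (centers B σ k).card ≤ leafCount n B k ^ n := by
  classical
  induction k with
  | zero => simp [centers, leafCount]
  | succ k ih =>
    rw [centers, leafCount_succ, mul_pow]
    refine (Finset.card_biUnion_le_card_mul _ _ _ fun c _ => Finset.card_image_le).trans ?_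
    simp only [Fintype.card_piFinset, Finset.card_range, Finset.prod_const, Finset.card_univ,
      Fintype.card_fin]
    gcongr

/-- Rounding, digit and translation move each coordinate by at most 2 M / N = 1 / (2 n D), hence the
centre by at most half the parent radius. The other half contains the child radius, so the balls are
nested. -/
lemma dist_childCenter_le (hn : 0 < n) {k : ℕ} (c : EuclideanSpace ℝ (Fin n))
    (hσ : ∀ i, |σ k c i| ≤ B k) {d : Fin n → ℕ} (hd : ∀ i, d i < branching n B k) :
    dist (childCenter (mesh n B k) (σ k c) c d) c
      ≤ (invRadius n B k : ℝ)⁻¹ - (invRadius n B (k + 1) : ℝ)⁻¹ := by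
  have hn' : (0 : ℝ) < n := by exact_mod_cast hn
  have hD : (0 : ℝ) < invRadius n B k := by exact_mod_cast invRadius_pos hn k
  have hM : (0 : ℝ) < branching n B k := by exact_mod_cast branching_pos hn k
  have hN : (1 : ℝ) ≤ mesh n B k := by exact_mod_cast mesh_pos hn k
  have hNeq : (mesh n B k : ℝ) = 4 * n * invRadius n B k * branching n B k := by
    simp [mesh]
  have hBM : (1 : ℝ) + B k ≤ branching n B k := by exact_mod_cast one_add_le_branching hn k
  have hDD : 2 * (invRadius n B k : ℝ) ≤ invRadius n B (k + 1) := by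
    exact_mod_cast two_mul_invRadius_le hn k
  have key : ∀ i, |(childCenter (mesh n B k) (σ k c) c d - c) i|
      ≤ (2 * n * invRadius n B k : ℝ)⁻¹ := by
    intro i
    set N : ℝ := (mesh n B k : ℝ)
    have hN0 : 0 < N := by linarith
    have hdi : (d i : ℝ) + 1 ≤ branching n B k := by exact_mod_cast hd i
    have hσi := hσ i
    have e : (childCenter (mesh n B k) (σ k c) c d - c) i
        = ((⌈N * c i⌉ - N * c i) + d i + σ k c i / N) / N := by
      change ((⌈N * c i⌉ : ℝ) + d i) / N + σ k c i / N ^ 2 - c i = _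
      field_simp
      ring
    have h1 := Int.le_ceil (N * c i)
    have h2 := (Int.ceil_lt_add_one (N * c i)).le
    have h3 : |σ k c i / N| ≤ B k := by
      rw [abs_div, abs_of_pos hN0]
      exact (div_le_self (abs_nonneg _) hN).trans hσi
    have hd0 : (0 : ℝ) ≤ d i := Nat.cast_nonneg _
    have e2 : (2 * n * invRadius n B k : ℝ)⁻¹ = 2 * branching n B k / N := by
      rw [hNeq]; field_simp; norm_num
    rw [e, abs_div, abs_of_pos hN0, e2]
    gcongr
    rw [abs_le] at h3 ⊢
    constructor <;> linarith [h3.1, h3.2]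
  rw [dist_eq_norm]
  refine (EuclideanSpace.norm_le_card_mul _ key).trans ?_
  have e3 : (n : ℝ) * (2 * n * invRadius n B k : ℝ)⁻¹ = (2 * invRadius n B k : ℝ)⁻¹ := by
    field_simp
  have e4 : (invRadius n B (k + 1) : ℝ)⁻¹ ≤ (2 * invRadius n B k : ℝ)⁻¹ := by gcongr
  have e5 : (invRadius n B k : ℝ)⁻¹ = (2 * invRadius n B k : ℝ)⁻¹ + (2 * invRadius n B k : ℝ)⁻¹ := by
    field_simp; norm_num
  rw [e3]
  linarith

lemma exists_lattice_approx (hn : 0 < n) (hσ : ∀ k x i, |σ k x i| ≤ B k)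
    {x : EuclideanSpace ℝ (Fin n)} (hx : x ∈ latticeCantor B σ) (k : ℕ) :
    ∃ p a : EuclideanSpace ℝ (Fin n), dist x p ≤ (invRadius n B k : ℝ)⁻¹ ∧
      (∀ i, ∃ z : ℤ, a i * mesh n B k = z) ∧
      dist x (a + ((mesh n B k : ℝ) ^ 2)⁻¹ • σ k p) ≤ (((k : ℝ) + 1) * (mesh n B k : ℝ) ^ 2)⁻¹ := by
  obtain ⟨c', hc', hxc⟩ := mem_latticeCantor.1 hx (k + 1)
  obtain ⟨c, -, d, hd, rfl⟩ := mem_centers_succ.1 hc'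
  have hN : (mesh n B k : ℝ) ≠ 0 := by exact_mod_cast (mesh_pos hn k).ne'
  refine ⟨c, WithLp.toLp 2 fun i => ((⌈mesh n B k * c i⌉ : ℝ) + d i) / mesh n B k, ?_, ?_, ?_⟩
  · have := dist_childCenter_le hn c (hσ k c) hd
    linarith [dist_triangle x (childCenter (mesh n B k) (σ k c) c d) c]
  · intro i
    exact ⟨⌈mesh n B k * c i⌉ + d i, by simp [div_mul_cancel₀ _ hN]⟩
  · have e : (WithLp.toLp 2 fun i => ((⌈mesh n B k * c i⌉ : ℝ) + d i) / mesh n B k)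
        + ((mesh n B k : ℝ) ^ 2)⁻¹ • σ k c = childCenter (mesh n B k) (σ k c) c d := by
      ext i
      simp [childCenter]
      ring
    rw [e]
    simpa [invRadius_succ] using hxc

lemma norm_le_one_of_mem (x : EuclideanSpace ℝ (Fin n)) (hx : x ∈ latticeCantor B σ) : ‖x‖ ≤ 1 := by
  simpa [centers, invRadius] using mem_latticeCantor.1 hx 0

lemma tendsto_inv_invRadius (hn : 0 < n) :
    Tendsto (fun k => (invRadius n B k : ℝ)⁻¹) atTop (𝓝 0) :=
  tendsto_inv_atTop_zero.comp <| tendsto_natCast_atTop_atTop.comp <|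
    tendsto_atTop_mono (le_invRadius hn) tendsto_id

/-! ### Upper bound for the dimension -/

lemma dimH_latticeCantor_le (hn : 0 < n) : dimH (latticeCantor B σ) ≤ (n : ℝ≥0∞) / 2 := by
  have hcov : μH[((n / 2 : ℝ≥0) : ℝ)] (latticeCantor B σ) ≤
      liminf (fun k => ∑ c : centers B σ k, Metric.ediam (Metric.closedBall (c : EuclideanSpace ℝ (Fin n))
        (invRadius n B k : ℝ)⁻¹) ^ ((n / 2 : ℝ≥0) : ℝ)) atTop := by
    refine Measure.hausdorffMeasure_le_liminf_sum _ _
      (fun k => ENNReal.ofReal (2 * (invRadius n B k : ℝ)⁻¹)) ?_ _ (.of_forall fun k c => ?_)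
      (.of_forall fun k => ?_)
    · have := (tendsto_inv_invRadius (B := B) hn).const_mul 2
      simpa using ENNReal.tendsto_ofReal this
    · refine Metric.ediam_le_of_forall_dist_le fun x hx y hy => ?_
      linarith [dist_triangle_right x y (c : EuclideanSpace ℝ (Fin n)), Metric.mem_closedBall.1 hx,
        Metric.mem_closedBall.1 hy]
    · intro x hx
      obtain ⟨c, hc, h⟩ := mem_latticeCantor.1 hx k
      exact Set.mem_iUnion.2 ⟨⟨c, hc⟩, h⟩
  have hbound : ∀ k, ∑ c : centers B σ k, Metric.ediam (Metric.closedBall (c : EuclideanSpace ℝ (Fin n))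
        (invRadius n B k : ℝ)⁻¹) ^ ((n / 2 : ℝ≥0) : ℝ) ≤ ENNReal.ofReal ((2 : ℝ) ^ ((n : ℝ) / 2)) := by
    intro k
    have hD : (0 : ℝ) < invRadius n B k := by exact_mod_cast invRadius_pos hn k
    have h1 : ∀ c : centers B σ k, Metric.ediam (Metric.closedBall (c : EuclideanSpace ℝ (Fin n))
        (invRadius n B k : ℝ)⁻¹) ^ ((n / 2 : ℝ≥0) : ℝ) ≤
        ENNReal.ofReal ((2 * (invRadius n B k : ℝ)⁻¹) ^ ((n : ℝ) / 2)) := by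
      intro c
      rw [← ENNReal.ofReal_rpow_of_nonneg (by positivity) (by positivity)]
      have e : ((n / 2 : ℝ≥0) : ℝ) = (n : ℝ) / 2 := by simp
      rw [e]
      gcongr
      refine Metric.ediam_le_of_forall_dist_le fun x hx y hy => ?_
      linarith [dist_triangle_right x y (c : EuclideanSpace ℝ (Fin n)), Metric.mem_closedBall.1 hx,
        Metric.mem_closedBall.1 hy]
    refine (Finset.sum_le_sum fun c _ => h1 c).trans ?_
    rw [Finset.sum_const, Finset.card_univ, Fintype.card_coe, nsmul_eq_mul,
      ← ENNReal.ofReal_natCast, ← ENNReal.ofReal_mul (by positivity)]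
    refine ENNReal.ofReal_le_ofReal ?_
    have h2 : ((centers B σ k).card : ℝ) ≤ (invRadius n B k : ℝ) ^ ((n : ℝ) / 2) := by
      have h3 : ((leafCount n B k : ℝ)) ^ 2 ≤ invRadius n B k := by
        exact_mod_cast leafCount_sq_le_invRadius hn k
      calc ((centers B σ k).card : ℝ) ≤ (leafCount n B k : ℝ) ^ n := by
            exact_mod_cast card_centers_le k
        _ = ((leafCount n B k : ℝ) ^ 2) ^ ((n : ℝ) / 2) := by
            rw [← Real.rpow_natCast _ 2, ← Real.rpow_mul (by positivity), ← Real.rpow_natCast]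
            congr 1
            push_cast
            ring
        _ ≤ _ := by gcongr
    calc ((centers B σ k).card : ℝ) * (2 * (invRadius n B k : ℝ)⁻¹) ^ ((n : ℝ) / 2)
        ≤ (invRadius n B k : ℝ) ^ ((n : ℝ) / 2) * (2 * (invRadius n B k : ℝ)⁻¹) ^ ((n : ℝ) / 2) := by
          gcongr
      _ = 2 ^ ((n : ℝ) / 2) := by
          rw [← Real.mul_rpow (by positivity) (by positivity)]
          congr 1
          field_simp
  have hfin : μH[((n / 2 : ℝ≥0) : ℝ)] (latticeCantor B σ) ≠ ∞ := by
    refine ne_top_of_le_ne_top (ENNReal.ofReal_ne_top (r := (2 : ℝ) ^ ((n : ℝ) / 2))) ?_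
    refine hcov.trans ?_
    exact (liminf_le_liminf (.of_forall hbound)).trans (by simp)
  refine (dimH_le_of_hausdorffMeasure_ne_top hfin).trans ?_
  rw [ENNReal.coe_div two_ne_zero]
  simp

end Cantor

/-! ### Lower bound for the dimension -/

/-- The index of the cell of generation `k` that contains the number `t` of the unit interval. -/
noncomputable def cellIndex (n : ℕ) (B : ℕ → ℕ) (k : ℕ) (t : ℝ) : ℕ := ⌊t * leafCount n B k⌋₊

/-- The centres of the balls in the branch of the Cantor set coded by a point of the unit cube. -/
noncomputable def branchCenter {n : ℕ} (B : ℕ → ℕ)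
    (σ : ℕ → EuclideanSpace ℝ (Fin n) → EuclideanSpace ℝ (Fin n)) (u : Fin n → ℝ) :
    ℕ → EuclideanSpace ℝ (Fin n)
  | 0 => 0
  | k + 1 => childCenter (mesh n B k) (σ k (branchCenter B σ u k)) (branchCenter B σ u k)
      fun i => cellIndex n B (k + 1) (u i) % branching n B k

section Coding

variable {n : ℕ} {B : ℕ → ℕ} {σ : ℕ → EuclideanSpace ℝ (Fin n) → EuclideanSpace ℝ (Fin n)}

/-- The cell indices are truncations of a mixed-radix expansion with the branching numbers as bases;
the division drops the last digit. -/
lemma cellIndex_succ_div (hn : 0 < n) (k : ℕ) (t : ℝ) :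
    cellIndex n B (k + 1) t / branching n B k = cellIndex n B k t := by
  have hM : (branching n B k : ℝ) ≠ 0 := by exact_mod_cast (branching_pos hn k).ne'
  rw [cellIndex, ← Nat.floor_div_natCast, leafCount_succ, cellIndex]
  congr 1
  push_cast
  field_simp

lemma branchCenter_congr (hn : 0 < n) {u v : Fin n → ℝ} {k : ℕ}
    (h : ∀ i, cellIndex n B k (u i) = cellIndex n B k (v i)) :
    branchCenter B σ u k = branchCenter B σ v k := by
  induction k with
  | zero => rfl
  | succ k ih =>
    have := ih fun i => by rw [← cellIndex_succ_div hn, h i, cellIndex_succ_div hn]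
    simp only [branchCenter, this, h]

lemma branchCenter_mem (hn : 0 < n) (u : Fin n → ℝ) (k : ℕ) :
    branchCenter B σ u k ∈ centers B σ k := by
  induction k with
  | zero => simp [branchCenter, centers]
  | succ k ih => exact mem_centers_succ.2 ⟨_, ih, _, fun i => Nat.mod_lt _ (branching_pos hn k), rfl⟩

lemma exists_limit_branchCenter (hn : 0 < n) (hσ : ∀ k x i, |σ k x i| ≤ B k) (u : Fin n → ℝ) :
    ∃ x, ∀ k, dist x (branchCenter B σ u k) ≤ (invRadius n B k : ℝ)⁻¹ := by
  obtain ⟨x, hx⟩ := IsCompact.nonempty_iInter_of_sequence_nonempty_isCompact_isClosed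
    (fun k => Metric.closedBall (branchCenter B σ u k) (invRadius n B k : ℝ)⁻¹)
    (fun k => Metric.closedBall_subset_closedBall' (by
      have := dist_childCenter_le hn (branchCenter B σ u k) (hσ k _)
        (d := fun i => cellIndex n B (k + 1) (u i) % branching n B k)
        fun i => Nat.mod_lt _ (branching_pos hn k)
      rw [branchCenter]
      linarith))
    (fun k => ⟨_, Metric.mem_closedBall_self (by positivity)⟩)
    (isCompact_closedBall _ _) (fun k => Metric.isClosed_closedBall)
  exact ⟨x, Set.mem_iInter.1 hx⟩

/-- Equal indices force |s - t| Q_k ≤ 1 for all k, but Q_k is unbounded: k ≤ D_k ≤ D_1 Q_k ^ 3. -/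
lemma exists_cellIndex_ne (hn : 0 < n) {s t : ℝ} (hs : 0 ≤ s) (ht : 0 ≤ t) (hst : s ≠ t) :
    ∃ k, cellIndex n B k s ≠ cellIndex n B k t := by
  by_contra! h
  have hpos : 0 < |s - t| := abs_pos.2 (sub_ne_zero.2 hst)
  have hQ : ∀ k, |s - t| * leafCount n B k ≤ 1 := by
    intro k
    have hQ0 : (0 : ℝ) ≤ leafCount n B k := Nat.cast_nonneg _
    have h1 := Nat.floor_le (mul_nonneg hs hQ0)
    have h2 := Nat.lt_floor_add_one (s * leafCount n B k)
    have h3 := Nat.floor_le (mul_nonneg ht hQ0)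
    have h4 := Nat.lt_floor_add_one (t * leafCount n B k)
    have h5 : (⌊s * leafCount n B k⌋₊ : ℝ) = ⌊t * leafCount n B k⌋₊ := by exact_mod_cast h k
    rw [← abs_of_nonneg hQ0, ← abs_mul, sub_mul, abs_le]
    constructor <;> linarith
  have hD : ∀ k : ℕ, |s - t| ^ 3 * k ≤ invRadius n B 1 := by
    intro k
    have h1 : (invRadius n B k : ℝ) ^ 1 ≤ invRadius n B 1 ^ 1 * leafCount n B k ^ (2 * 1 + 1) := by
      exact_mod_cast invRadius_pow_le hn 1 k
    have h2 : (k : ℝ) ≤ invRadius n B k := by exact_mod_cast le_invRadius hn k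
    calc |s - t| ^ 3 * k ≤ |s - t| ^ 3 * (invRadius n B 1 * leafCount n B k ^ 3) := by
          gcongr
          norm_num at h1
          linarith
      _ = invRadius n B 1 * (|s - t| * leafCount n B k) ^ 3 := by ring
      _ ≤ invRadius n B 1 * 1 ^ 3 := by
          gcongr
          exact hQ k
      _ = invRadius n B 1 := by ring
  obtain ⟨k, hk⟩ := exists_nat_gt ((invRadius n B 1 : ℝ) / |s - t| ^ 3)
  have h6 := hD k
  rw [div_lt_iff₀ (by positivity)] at hk
  linarith

/-- Two points of the unit cube separate at some generation; this compares their distance with the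
distance of the points that they code. -/
lemma exists_separation (hn : 0 < n) {u v : Fin n → ℝ} (hu : ∀ i, 0 ≤ u i ∧ u i < 1)
    (hv : ∀ i, 0 ≤ v i ∧ v i < 1) (huv : u ≠ v) {x y : EuclideanSpace ℝ (Fin n)}
    (hx : ∀ k, dist x (branchCenter B σ u k) ≤ (invRadius n B k : ℝ)⁻¹)
    (hy : ∀ k, dist y (branchCenter B σ v k) ≤ (invRadius n B k : ℝ)⁻¹) :
    ∃ k J : ℕ, 1 ≤ J ∧ J ≤ branching n B k ∧
      (∀ i, |u i - v i| ≤ 2 * J / (leafCount n B k * branching n B k)) ∧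
      (J : ℝ) / (2 * mesh n B k) ≤ dist x y := by
  classical
  have hex : ∃ k, ∃ i, cellIndex n B k (u i) ≠ cellIndex n B k (v i) := by
    obtain ⟨i, hi⟩ := Function.ne_iff.1 huv
    obtain ⟨k, hk⟩ := exists_cellIndex_ne hn (hu i).1 (hv i).1 hi
    exact ⟨k, i, hk⟩
  -- In generation 0 all indices are 0, because the coordinates lie in [0, 1).
  obtain ⟨k, hk⟩ : ∃ k, Nat.find hex = k + 1 := by
    refine Nat.exists_eq_succ_of_ne_zero fun h0 => ?_
    obtain ⟨i, hi⟩ := h0 ▸ Nat.find_spec hex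
    apply hi
    simp [cellIndex, leafCount, Nat.floor_eq_zero.2 (hu i).2, Nat.floor_eq_zero.2 (hv i).2]
  obtain ⟨i₁, hi₁⟩ := hk ▸ Nat.find_spec hex
  have hlt : ∀ i, cellIndex n B k (u i) = cellIndex n B k (v i) := by
    have := Nat.find_min hex (m := k) (by lia)
    push Not at this
    exact this
  have : Nonempty (Fin n) := ⟨i₁⟩
  -- J is the largest difference of the last digits; up to generation k the two codes agree.
  set f : Fin n → ℕ := fun i =>
    ((cellIndex n B (k + 1) (u i) : ℤ) - cellIndex n B (k + 1) (v i)).natAbs with hf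
  obtain ⟨i₀, hi₀⟩ := Finite.exists_max f
  have hM := branching_pos (B := B) hn k
  have hmod : ∀ i, (cellIndex n B (k + 1) (u i) : ℤ) - cellIndex n B (k + 1) (v i)
      = (cellIndex n B (k + 1) (u i) % branching n B k : ℕ)
        - (cellIndex n B (k + 1) (v i) % branching n B k : ℕ) := by
    intro i
    have h1 := Nat.div_add_mod (cellIndex n B (k + 1) (u i)) (branching n B k)
    have h2 := Nat.div_add_mod (cellIndex n B (k + 1) (v i)) (branching n B k)
    rw [cellIndex_succ_div hn] at h1 h2
    rw [hlt i] at h1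
    lia
  have habs : ∀ i, (f i : ℝ) =
      |(cellIndex n B (k + 1) (u i) : ℝ) - cellIndex n B (k + 1) (v i)| := by
    intro i
    simp [hf, Nat.cast_natAbs]
  have hJ1 : 1 ≤ f i₀ := by
    refine le_trans ?_ (hi₀ i₁)
    simp only [hf]
    lia
  refine ⟨k, f i₀, hJ1, ?_, fun i => ?_, ?_⟩
  · have h1 := Nat.mod_lt (cellIndex n B (k + 1) (u i₀)) hM
    have h2 := Nat.mod_lt (cellIndex n B (k + 1) (v i₀)) hM
    have h3 := hmod i₀
    simp only [hf]
    lia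
  · have hQ : (0 : ℝ) < leafCount n B (k + 1) := by exact_mod_cast leafCount_pos hn _
    have hQe : (leafCount n B k : ℝ) * branching n B k = leafCount n B (k + 1) := by
      rw [leafCount_succ]; push_cast; rfl
    have h1 := Nat.floor_le (mul_nonneg (hu i).1 hQ.le)
    have h2 := Nat.lt_floor_add_one (u i * leafCount n B (k + 1))
    have h3 := Nat.floor_le (mul_nonneg (hv i).1 hQ.le)
    have h4 := Nat.lt_floor_add_one (v i * leafCount n B (k + 1))
    have h5 : |(cellIndex n B (k + 1) (u i) : ℝ) - cellIndex n B (k + 1) (v i)| ≤ f i₀ := by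
      rw [← habs]; exact_mod_cast hi₀ i
    have h6 : (1 : ℝ) ≤ f i₀ := by exact_mod_cast hJ1
    rw [hQe, le_div_iff₀ hQ, ← abs_of_pos hQ, ← abs_mul, sub_mul, abs_le]
    rw [abs_le] at h5
    simp only [cellIndex] at h5
    constructor <;> linarith [h5.1, h5.2]
  · have hN : (0 : ℝ) < mesh n B k := by exact_mod_cast mesh_pos hn k
    have hN4 : (4 : ℝ) ≤ mesh n B k := by
      have h1 := four_mul_invRadius_le_mesh (B := B) hn k
      have h2 := invRadius_pos (B := B) hn k
      exact_mod_cast (by lia : 4 ≤ mesh n B k)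
    have hD : (invRadius n B (k + 1) : ℝ)⁻¹ ≤ 1 / (4 * mesh n B k) := by
      rw [← one_div]
      have h1 : (mesh n B k : ℝ) ^ 2 ≤ invRadius n B (k + 1) := by
        exact_mod_cast mesh_sq_le_invRadius k
      gcongr
      nlinarith
    -- The parent is common, so rounding and translation cancel and only the digits differ.
    have hcc : dist (branchCenter B σ u (k + 1)) (branchCenter B σ v (k + 1))
        ≥ f i₀ / mesh n B k := by
      rw [dist_eq_norm]
      refine le_trans (le_of_eq ?_) (PiLp.norm_apply_le _ i₀)
      have hm : ((cellIndex n B (k + 1) (u i₀) : ℝ)) - cellIndex n B (k + 1) (v i₀)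
          = (cellIndex n B (k + 1) (u i₀) % branching n B k : ℕ)
            - (cellIndex n B (k + 1) (v i₀) % branching n B k : ℕ) := by
        exact_mod_cast congrArg (fun z : ℤ => (z : ℝ)) (hmod i₀)
      rw [habs, hm]
      simp only [branchCenter, branchCenter_congr hn hlt, childCenter, PiLp.sub_apply]
      rw [Real.norm_eq_abs, ← abs_of_pos hN, ← abs_div, abs_of_pos hN]
      congr 1
      ring
    have h1 := hx (k + 1)
    have h2 := hy (k + 1)
    have h3 := dist_triangle4 (branchCenter B σ u (k + 1)) x y (branchCenter B σ v (k + 1))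
    rw [dist_comm _ x] at h3
    have h6 : (1 : ℝ) ≤ f i₀ := by exact_mod_cast hJ1
    have h7 : (1 : ℝ) / (4 * mesh n B k) ≤ f i₀ / (4 * mesh n B k) := by gcongr
    have h8 : (f i₀ : ℝ) / mesh n B k = f i₀ / (2 * mesh n B k) + 2 * (f i₀ / (4 * mesh n B k)) := by
      field_simp; norm_num
    linarith

/-- With s = m / (2m + 1) < 1/2 and θ = J / M_k ≤ 1, the bound follows from D_k ^ s ≤ K Q_k, the
root of `invRadius_pow_le`, and from θ ≤ θ ^ s. -/
lemma exists_holder_bound (hn : 0 < n) (m : ℕ) : ∃ C : ℝ≥0, ∀ k J : ℕ, 1 ≤ J →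
    J ≤ branching n B k → 2 * (J : ℝ) / (leafCount n B k * branching n B k) ≤
      C * ((J : ℝ) / (2 * mesh n B k)) ^ ((m : ℝ) / (2 * m + 1)) := by
  have hn' : (0 : ℝ) < n := by exact_mod_cast hn
  have hn1 : (1 : ℝ) ≤ n := by exact_mod_cast hn
  refine ⟨(16 * n * invRadius n B m ^ m : ℕ), fun k J hJ hJM => ?_⟩
  set s : ℝ := (m : ℝ) / (2 * m + 1) with hs
  have hs0 : 0 ≤ s := by positivity
  have hs1 : s ≤ 1 := by
    rw [hs, div_le_one (by positivity)]
    linarith [(Nat.cast_nonneg m : (0 : ℝ) ≤ m)]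
  have hD : (0 : ℝ) < invRadius n B k := by exact_mod_cast invRadius_pos hn k
  have hM : (0 : ℝ) < branching n B k := by exact_mod_cast branching_pos hn k
  have hQ : (0 : ℝ) < leafCount n B k := by exact_mod_cast leafCount_pos hn k
  have hJ0 : (0 : ℝ) < J := by exact_mod_cast hJ
  set K : ℝ := (invRadius n B m : ℝ) ^ m with hK
  have hK1 : 1 ≤ K := one_le_pow₀ (by exact_mod_cast invRadius_pos hn m)
  set θ : ℝ := J / branching n B k with hθ
  have hθ0 : 0 < θ := by positivity
  have hθ1 : θ ≤ 1 := by
    rw [hθ, div_le_one hM]; exact_mod_cast hJM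
  have hDs : (invRadius n B k : ℝ) ^ s ≤ K * leafCount n B k := by
    have h1 : (invRadius n B k : ℝ) ^ m ≤ K * leafCount n B k ^ (2 * m + 1) := by
      rw [hK]
      exact_mod_cast invRadius_pow_le hn m k
    have hm : (0 : ℝ) < 2 * m + 1 := by positivity
    calc (invRadius n B k : ℝ) ^ s
        = ((invRadius n B k : ℝ) ^ m) ^ (1 / (2 * (m : ℝ) + 1)) := by
          rw [← Real.rpow_natCast, ← Real.rpow_mul hD.le, hs]
          congr 1
          ring
      _ ≤ (K * leafCount n B k ^ (2 * m + 1)) ^ (1 / (2 * (m : ℝ) + 1)) := by gcongr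
      _ = K ^ (1 / (2 * (m : ℝ) + 1)) * leafCount n B k := by
          rw [Real.mul_rpow (by positivity) (by positivity)]
          congr 1
          rw [← Real.rpow_natCast, ← Real.rpow_mul hQ.le]
          push_cast
          rw [mul_one_div_cancel hm.ne', Real.rpow_one]
      _ ≤ K ^ (1 : ℝ) * leafCount n B k := by
          gcongr
          · rw [div_le_one hm]; linarith [(Nat.cast_nonneg m : (0 : ℝ) ≤ m)]
      _ = _ := by rw [Real.rpow_one]
  have hθs : θ ≤ θ ^ s := by
    simpa using Real.rpow_le_rpow_of_exponent_ge hθ0 hθ1 hs1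
  have h8s : (8 * n : ℝ) ^ s ≤ 8 * n := by
    simpa using Real.rpow_le_rpow_of_exponent_le (by linarith : (1 : ℝ) ≤ 8 * n) hs1
  have e1 : (J : ℝ) / (2 * mesh n B k) = θ / (8 * n * invRadius n B k) := by
    rw [hθ, mesh]; push_cast; field_simp; norm_num
  have e2 : 2 * (J : ℝ) / (leafCount n B k * branching n B k) = 2 * θ / leafCount n B k := by
    rw [hθ]; field_simp
  have e3 : (((16 * n * invRadius n B m ^ m : ℕ) : ℝ≥0) : ℝ) = 16 * n * K := by
    rw [hK]; push_cast; rfl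
  rw [e1, e2, e3, Real.div_rpow hθ0.le (by positivity), Real.mul_rpow (by positivity) hD.le]
  calc 2 * θ / leafCount n B k = 16 * n * K * (θ / (8 * n * (K * leafCount n B k))) := by
        field_simp; norm_num
    _ ≤ 16 * n * K * (θ ^ s / ((8 * n) ^ s * (invRadius n B k) ^ s)) := by gcongr

/-- Decoding is Hölder with exponent m / (2m + 1) from a subset of the Cantor set onto the cube,
whose dimension is n. -/
lemma le_dimH_latticeCantor_of_nat (hn : 0 < n) (hσ : ∀ k x i, |σ k x i| ≤ B k) {m : ℕ}
    (hm : 0 < m) : (n : ℝ≥0∞) * ((m / (2 * m + 1) : ℝ≥0) : ℝ≥0∞) ≤ dimH (latticeCantor B σ) := by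
  choose X hX using exists_limit_branchCenter hn hσ
  set I : Set (Fin n → ℝ) := Set.univ.pi fun _ => Set.Ico (0 : ℝ) 1 with hI
  have hI' : ∀ u ∈ I, ∀ i, 0 ≤ u i ∧ u i < 1 := fun u hu i => hu i trivial
  obtain ⟨C, hC⟩ := exists_holder_bound (B := B) hn m
  have hbound : ∀ u ∈ I, ∀ v ∈ I,
      dist u v ≤ C * dist (X u) (X v) ^ ((m : ℝ) / (2 * m + 1)) := by
    intro u hu v hv
    by_cases huv : u = v
    · subst huv
      rw [dist_self]
      positivity
    obtain ⟨k, J, hJ, hJM, h1, h2⟩ := exists_separation hn (hI' u hu) (hI' v hv) huv (hX u) (hX v)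
    rw [dist_pi_le_iff (by positivity)]
    intro i
    rw [Real.dist_eq]
    refine (h1 i).trans ((hC k J hJ hJM).trans ?_)
    gcongr
  have hm' : (0 : ℝ) < m := by exact_mod_cast hm
  have hinj : Set.InjOn X I := by
    intro u hu v hv h
    have := hbound u hu v hv
    rw [h, dist_self, Real.zero_rpow (by positivity), mul_zero] at this
    exact dist_le_zero.1 this
  have hr : (0 : ℝ≥0) < m / (2 * m + 1) := by
    have : (0 : ℝ≥0) < m := by exact_mod_cast hm
    positivity
  have hhol : HolderOnWith C (m / (2 * m + 1) : ℝ≥0) (Function.invFunOn X I) (X '' I) := by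
    rintro _ ⟨u, hu, rfl⟩ _ ⟨v, hv, rfl⟩
    rw [hinj.leftInvOn_invFunOn hu, hinj.leftInvOn_invFunOn hv, edist_dist, edist_dist,
      ENNReal.ofReal_rpow_of_nonneg dist_nonneg (by positivity), ← ENNReal.ofReal_coe_nnreal,
      ← ENNReal.ofReal_mul (by positivity)]
    refine ENNReal.ofReal_le_ofReal ?_
    simpa using hbound u hu v hv
  have himage : Function.invFunOn X I '' (X '' I) = I := by
    rw [← Set.image_comp]
    exact (Set.image_congr fun u hu => hinj.leftInvOn_invFunOn hu).trans (Set.image_id _)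
  have hdim := hhol.dimH_image_le hr
  have hIdim : dimH I = n := by
    rw [Real.dimH_of_nonempty_interior, Module.finrank_fin_fun]
    refine ⟨fun _ => 1 / 2, ?_⟩
    rw [hI, interior_pi_set Set.finite_univ]
    intro i _
    norm_num [interior_Ico]
  rw [himage, hIdim] at hdim
  have hmono : dimH (X '' I) ≤ dimH (latticeCantor B σ) := by
    refine dimH_mono ?_
    rintro _ ⟨u, -, rfl⟩
    exact mem_latticeCantor.2 fun k => ⟨_, branchCenter_mem hn u k, hX u k⟩
  refine le_trans ?_ hmono
  exact (ENNReal.le_div_iff_mul_le (.inl (by exact_mod_cast hr.ne')) (.inl ENNReal.coe_ne_top)).1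
    hdim

theorem dimH_latticeCantor (hn : 0 < n) (hσ : ∀ k x i, |σ k x i| ≤ B k) :
    dimH (latticeCantor B σ) = (n : ℝ≥0∞) / 2 := by
  refine le_antisymm (dimH_latticeCantor_le hn) ?_
  have hlim : Tendsto (fun m : ℕ => (m / (2 * m + 1) : ℝ≥0)) atTop (𝓝 (1 / 2)) := by
    rw [← NNReal.tendsto_coe]
    have h : Tendsto (fun m : ℕ => 1 / (2 + ((m : ℝ))⁻¹)) atTop (𝓝 (1 / (2 + 0))) :=
      tendsto_const_nhds.div
        (tendsto_const_nhds.add (tendsto_inv_atTop_zero.comp tendsto_natCast_atTop_atTop))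
        (by norm_num)
    have e : ((1 / 2 : ℝ≥0) : ℝ) = 1 / (2 + 0) := by norm_num
    rw [e]
    refine h.congr' ?_
    filter_upwards [eventually_gt_atTop 0] with m hm
    have hm' : (m : ℝ) ≠ 0 := by exact_mod_cast hm.ne'
    push_cast
    field_simp
  have h2 : Tendsto (fun m : ℕ => (n : ℝ≥0∞) * ((m / (2 * m + 1) : ℝ≥0) : ℝ≥0∞)) atTop
      (𝓝 ((n : ℝ≥0∞) * ((1 / 2 : ℝ≥0) : ℝ≥0∞))) :=
    ENNReal.Tendsto.const_mul (ENNReal.tendsto_coe.2 hlim) (.inr (ENNReal.natCast_ne_top n))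
  have e : (n : ℝ≥0∞) * ((1 / 2 : ℝ≥0) : ℝ≥0∞) = n / 2 := by
    rw [ENNReal.coe_div two_ne_zero, div_eq_mul_inv, div_eq_mul_inv]
    simp
  rw [← e]
  refine le_of_tendsto h2 ?_
  filter_upwards [eventually_gt_atTop 0] with m hm using le_dimH_latticeCantor_of_nat hn hσ hm

end Coding

/-! ### Sets that lie close to translated lattices -/

/-- The vector `a` belongs to the lattice of mesh `1 / N`. -/
def InLattice {n : ℕ} (N : ℕ) (a : EuclideanSpace ℝ (Fin n)) : Prop := ∀ i, ∃ z : ℤ, a i * N = z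

/-- For every `k`, each point of `E` lies within `1 / ((k + 1) * N k ^ 2)` of a point of the lattice
of mesh `1 / N k`, translated by `σ k p / N k ^ 2` for some `p` close to the point. -/
def NearTranslatedLattices {n : ℕ} (N : ℕ → ℕ) (δ : ℕ → ℝ)
    (σ : ℕ → EuclideanSpace ℝ (Fin n) → EuclideanSpace ℝ (Fin n))
    (E : Set (EuclideanSpace ℝ (Fin n))) : Prop :=
  ∀ x ∈ E, ∀ k, ∃ p a, dist x p ≤ δ k ∧ InLattice (N k) a ∧
    dist x (a + ((N k : ℝ) ^ 2)⁻¹ • σ k p) ≤ (((k : ℝ) + 1) * (N k : ℝ) ^ 2)⁻¹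

section Avoidance

variable {n : ℕ} {N : ℕ → ℕ} {δ : ℕ → ℝ}
  {σ : ℕ → EuclideanSpace ℝ (Fin n) → EuclideanSpace ℝ (Fin n)}
  {E : Set (EuclideanSpace ℝ (Fin n))}

lemma InLattice.exists_norm_sub_sq {N : ℕ} {a b : EuclideanSpace ℝ (Fin n)} (ha : InLattice N a)
    (hb : InLattice N b) : ∃ z : ℤ, ‖a - b‖ ^ 2 * N ^ 2 = z := by
  choose f hf using ha
  choose g hg using hb
  refine ⟨∑ i, (f i - g i) ^ 2, ?_⟩
  rw [EuclideanSpace.real_norm_sq_eq, Finset.sum_mul]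
  push_cast
  refine Finset.sum_congr rfl fun i _ => ?_
  rw [← hf, ← hg, PiLp.sub_apply]
  ring

/-- If a function that takes values in `ℤ / N ^ 2` on the lattice of mesh `1 / N` vanishes at a
tuple of points of `E`, then it is stationary in the direction of a point that is different from
the other ones. -/
lemma hasDerivAt_eq_zero_of_apply_eq_zero {ι : Type*} [Fintype ι] [DecidableEq ι]
    (hE : NearTranslatedLattices N δ σ E) (hN : Tendsto N atTop atTop) (hN0 : ∀ k, 0 < N k)
    (hδ : Tendsto δ atTop (𝓝 0))
    (hσ : ∀ U ∈ countableBasis (EuclideanSpace ℝ (Fin n)), ∀ j, ∃ᶠ k in atTop,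
      σ k = U.indicator fun _ => denseSeq (EuclideanSpace ℝ (Fin n)) j)
    {u : ι → EuclideanSpace ℝ (Fin n)} (hu : ∀ j, u j ∈ E) {i₀ : ι} (hne : ∀ j ≠ i₀, u j ≠ u i₀)
    {G : (ι → EuclideanSpace ℝ (Fin n)) → ℝ} (hG : DifferentiableAt ℝ G u)
    (hint : ∀ᶠ k in atTop, ∀ b : ι → EuclideanSpace ℝ (Fin n), (∀ j, InLattice (N k) (b j)) →
      ∃ z : ℤ, G b * N k ^ 2 = z) (h0 : G u = 0) (v : EuclideanSpace ℝ (Fin n)) {l : ℝ}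
    (hl : HasDerivAt (fun t : ℝ => G (u + t • (Pi.single i₀ v : ι → EuclideanSpace ℝ (Fin n)))) l 0) : l = 0 := by
  set G' := fderiv ℝ G u with hG'
  have hlG : l = G' (Pi.single i₀ v) := by
    have hline : HasDerivAt (fun t : ℝ => u + t • (Pi.single i₀ v : ι → EuclideanSpace ℝ (Fin n))) (Pi.single i₀ v) 0 := by
      simpa using ((hasDerivAt_id (0 : ℝ)).smul_const (Pi.single i₀ v : ι → EuclideanSpace ℝ (Fin n))).const_add u
    have hG0 : HasFDerivAt G G' (u + (0 : ℝ) • (Pi.single i₀ v : ι → EuclideanSpace ℝ (Fin n))) := by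
      simpa using hG.hasFDerivAt
    exact hl.unique (hG0.comp_hasDerivAt (0 : ℝ) hline)
  rw [hlG]
  by_contra hv
  let ℓ : EuclideanSpace ℝ (Fin n) →L[ℝ] ℝ := G'.comp (ContinuousLinearMap.single ℝ (fun _ : ι => EuclideanSpace ℝ (Fin n)) i₀)
  have hℓ : ∀ τ, ℓ τ = G' (Pi.single i₀ τ) := fun τ => by simp [ℓ]
  -- A nonzero functional takes the value 1/2, so by density some available translation τ has 0 < ℓ
  -- τ < 1.
  obtain ⟨j, hj⟩ : ∃ j, denseSeq (EuclideanSpace ℝ (Fin n)) j ∈ ℓ ⁻¹' Set.Ioo 0 1 := by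
    refine (denseRange_denseSeq (EuclideanSpace ℝ (Fin n))).exists_mem_open (isOpen_Ioo.preimage ℓ.continuous)
      ⟨(2 * ℓ v)⁻¹ • v, ?_⟩
    rw [← hℓ] at hv
    have : ℓ ((2 * ℓ v)⁻¹ • v) = 1 / 2 := by
      rw [map_smul, smul_eq_mul]; field_simp
    rw [Set.mem_preimage, this]
    norm_num
  set τ := denseSeq (EuclideanSpace ℝ (Fin n)) j with hτ
  have hnhds : {y | ∃ j, j ≠ i₀ ∧ u j = y}ᶜ ∈ 𝓝 (u i₀) := by
    refine IsOpen.mem_nhds (Set.Finite.isClosed ?_).isOpen_compl ?_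
    · exact (Set.finite_range u).subset fun y ⟨j, _, h⟩ => ⟨j, h⟩
    · rintro ⟨j, hj, h⟩
      exact hne j hj h
  -- The closure of U must miss the other points, so that their nearby parent centres are eventually
  -- outside U.
  obtain ⟨U, hUB, hU, hUc⟩ := (isBasis_countableBasis (EuclideanSpace ℝ (Fin n))).exists_closure_subset hnhds
  set F : Filter ℕ := atTop ⊓ 𝓟 {k | σ k = U.indicator fun _ => τ} with hF
  have : F.NeBot := frequently_mem_iff_neBot.1 (hσ U hUB j)
  have hFσ : ∀ᶠ k in F, σ k = U.indicator fun _ => τ :=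
    mem_inf_of_right (mem_principal_self _)
  choose P A hP hA hPA using fun j k => hE (u j) (hu j) k
  have hPt : ∀ j, Tendsto (P j) F (𝓝 (u j)) := fun j => by
    rw [tendsto_iff_dist_tendsto_zero]
    exact squeeze_zero (fun _ => dist_nonneg) (fun k => by rw [dist_comm]; exact hP j k)
      (hδ.mono_left inf_le_left)
  have hshift : ∀ j, ∀ᶠ k in F, σ k (P j k) = (Pi.single i₀ τ : ι → EuclideanSpace ℝ (Fin n)) j := by
    intro j
    by_cases hj : j = i₀
    · subst hj
      filter_upwards [hFσ, (hPt j).eventually_mem ((isOpen_of_mem_countableBasis hUB).mem_nhds hU)]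
        with k h1 h2
      rw [h1, Set.indicator_of_mem h2, Pi.single_eq_same]
    · have hmem : u j ∈ (closure U)ᶜ := fun h => hUc h ⟨j, hj, rfl⟩
      filter_upwards [hFσ, (hPt j).eventually_mem (isClosed_closure.isOpen_compl.mem_nhds hmem)]
        with k h1 h2
      rw [h1, Set.indicator_of_notMem fun h => h2 (subset_closure h), Pi.single_eq_of_ne hj]
  have hNF : Tendsto (fun k => ((N k : ℝ) ^ 2)) F atTop :=
    (tendsto_pow_atTop two_ne_zero).comp <|
      (tendsto_natCast_atTop_atTop.comp hN).mono_left inf_le_left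
  have hN0' : ∀ k, (0 : ℝ) < (N k : ℝ) ^ 2 := fun k => by
    have := hN0 k
    positivity
  -- On the scale N ^ (-2), the lattice points differ from u only by the translation of the point `u
  -- i₀`.
  have hd : Tendsto (fun k => ((N k : ℝ) ^ 2) • ((fun j => A j k) - u)) F
      (𝓝 (-(Pi.single i₀ τ : ι → EuclideanSpace ℝ (Fin n)))) := by
    rw [tendsto_pi_nhds]
    intro j
    rw [tendsto_iff_norm_sub_tendsto_zero]
    have hlim : Tendsto (fun k : ℕ => 1 / ((k : ℝ) + 1)) F (𝓝 0) :=
      tendsto_one_div_add_atTop_nhds_zero_nat.mono_left inf_le_left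
    refine squeeze_zero' (.of_forall fun _ => norm_nonneg _) ?_ hlim
    filter_upwards [hshift j] with k hk
    have e : (((N k : ℝ) ^ 2) • ((fun j => A j k) - u)) j - (-(Pi.single i₀ τ : ι → EuclideanSpace ℝ (Fin n))) j
        = ((N k : ℝ) ^ 2) • (A j k + ((N k : ℝ) ^ 2)⁻¹ • σ k (P j k) - u j) := by
      simp only [hk, Pi.smul_apply, Pi.sub_apply, Pi.neg_apply]
      rw [smul_sub, smul_sub, smul_add, smul_smul, mul_inv_cancel₀ (hN0' k).ne', one_smul]
      abel
    rw [e, norm_smul, ← dist_eq_norm, dist_comm, Real.norm_of_nonneg (hN0' k).le]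
    calc (N k : ℝ) ^ 2 * dist (u j) (A j k + ((N k : ℝ) ^ 2)⁻¹ • σ k (P j k))
        ≤ (N k : ℝ) ^ 2 * (((k : ℝ) + 1) * (N k : ℝ) ^ 2)⁻¹ := by
          gcongr
          exact hPA j k
      _ = 1 / ((k : ℝ) + 1) := by
          have : (N k : ℝ) ≠ 0 := by exact_mod_cast (hN0 k).ne'
          field_simp
  have hd0 : Tendsto (fun k => (fun j => A j k) - u) F (𝓝 0) := by
    have h := hNF.inv_tendsto_atTop.smul hd
    rw [zero_smul] at h
    refine h.congr fun k => ?_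
    rw [Pi.inv_apply, smul_smul, inv_mul_cancel₀ (hN0' k).ne', one_smul]
  have hlim := (hasFDerivWithinAt_univ.2 hG.hasFDerivAt).lim hd0 (.of_forall fun _ => trivial) hd
  -- The integers N ^ 2 G(A) converge to this derivative, and ℤ is closed in ℝ.
  have hmem : G' (-(Pi.single i₀ τ : ι → EuclideanSpace ℝ (Fin n))) ∈ Set.range ((↑) : ℤ → ℝ) := by
    refine Int.isClosedEmbedding_coe_real.isClosed_range.mem_of_tendsto hlim ?_
    filter_upwards [hint.filter_mono inf_le_left] with k hk
    obtain ⟨z, hz⟩ := hk (fun j => A j k) fun j => hA j k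
    refine ⟨z, ?_⟩
    rw [← hz, h0, add_sub_cancel, sub_zero, smul_eq_mul, mul_comm]
  obtain ⟨z, hz⟩ := hmem
  rw [map_neg, ← hℓ] at hz
  obtain ⟨h1, h2⟩ := hj
  have h3 : (z : ℝ) < 0 := by linarith
  have h4 : (-1 : ℝ) < z := by linarith
  have h5 : z < 0 := by exact_mod_cast h3
  have h6 : -1 < z := by exact_mod_cast h4
  lia

lemma hasDerivAt_norm_line_sq_sub (d : EuclideanSpace ℝ (Fin n)) (c : ℝ) :
    HasDerivAt (fun t : ℝ => ‖d + t • d‖ ^ 2 - c) (2 * ‖d‖ ^ 2) 0 := by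
  have e : (fun t : ℝ => ‖d + t • d‖ ^ 2 - c) = fun t : ℝ => (1 + t) ^ 2 * ‖d‖ ^ 2 - c := by
    ext t
    rw [show d + t • d = (1 + t) • d by rw [add_smul, one_smul], norm_smul, mul_pow, Real.norm_eq_abs, sq_abs]
  rw [e]
  simpa using ((((hasDerivAt_id (0 : ℝ)).const_add 1).pow 2).mul_const (‖d‖ ^ 2)).sub_const c

/-! ### Irrationality and uniqueness of distances and directions -/

section Consequences

variable (hE : NearTranslatedLattices N δ σ E) (hN : Tendsto N atTop atTop) (hN0 : ∀ k, 0 < N k)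
  (hδ : Tendsto δ atTop (𝓝 0))
  (hσ : ∀ U ∈ countableBasis (EuclideanSpace ℝ (Fin n)), ∀ j, ∃ᶠ k in atTop,
    σ k = U.indicator fun _ => denseSeq (EuclideanSpace ℝ (Fin n)) j)

include hE hN hN0 hδ hσ

lemma irrational_dist (hfac : ∀ k, k.factorial ∣ N k) {x y : EuclideanSpace ℝ (Fin n)}
    (hx : x ∈ E) (hy : y ∈ E) (hxy : x ≠ y) : Irrational (dist x y) := by
  rintro ⟨q, hq⟩
  have h := hasDerivAt_eq_zero_of_apply_eq_zero hE hN hN0 hδ hσ (u := ![x, y]) (i₀ := 0)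
    (G := fun b => ‖b 0 - b 1‖ ^ 2 - (q : ℝ) ^ 2)
    (by intro j; fin_cases j <;> simpa) (by intro j hj; fin_cases j <;> simp_all [eq_comm])
    (DifferentiableAt.sub_const (DifferentiableAt.norm_sq ℝ (by fun_prop)) _)
    (by
      filter_upwards [eventually_ge_atTop q.den] with k hk b hb
      obtain ⟨z, hz⟩ := (hb 0).exists_norm_sub_sq (hb 1)
      obtain ⟨c, hc⟩ := (Nat.dvd_factorial q.den_pos hk).trans (hfac k)
      refine ⟨z - (q.num * c) ^ 2, ?_⟩
      have hqd : (q : ℝ) * q.den = q.num := by exact_mod_cast Rat.mul_den_eq_num q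
      push_cast
      rw [← hz, ← hqd, hc]
      push_cast
      ring)
    (by simp [hq, dist_eq_norm]) (x - y) (l := 2 * ‖x - y‖ ^ 2)
    (by
      convert hasDerivAt_norm_line_sq_sub (x - y) ((q : ℝ) ^ 2) using 5 with t
      simp
      abel)
  have : ‖x - y‖ = 0 := by simpa using h
  exact hxy (sub_eq_zero.1 (norm_eq_zero.1 this))

/-- Only x is moved, so coincidences among y, z and w are harmless. Moving x along x - y changes the
first squared distance at rate 2 ‖x - y‖ ^ 2. -/
lemma dist_ne_dist {x y z w : EuclideanSpace ℝ (Fin n)} (hx : x ∈ E) (hy : y ∈ E) (hz : z ∈ E)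
    (hw : w ∈ E) (hxy : x ≠ y) (hxz : x ≠ z) (hxw : x ≠ w) : dist x y ≠ dist z w := by
  intro hd
  have h := hasDerivAt_eq_zero_of_apply_eq_zero hE hN hN0 hδ hσ (u := ![x, y, z, w]) (i₀ := 0)
    (G := fun b => ‖b 0 - b 1‖ ^ 2 - ‖b 2 - b 3‖ ^ 2)
    (by intro j; fin_cases j <;> simpa) (by intro j hj; fin_cases j <;> simp_all [eq_comm])
    (DifferentiableAt.sub (DifferentiableAt.norm_sq ℝ (by fun_prop))
      (DifferentiableAt.norm_sq ℝ (by fun_prop)))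
    (by
      refine .of_forall fun k b hb => ?_
      obtain ⟨p, hp⟩ := (hb 0).exists_norm_sub_sq (hb 1)
      obtain ⟨q, hq⟩ := (hb 2).exists_norm_sub_sq (hb 3)
      exact ⟨p - q, by push_cast; rw [sub_mul, hp, hq]⟩)
    (by simp [← dist_eq_norm, hd]) (x - y) (l := 2 * ‖x - y‖ ^ 2)
    (by
      convert hasDerivAt_norm_line_sq_sub (x - y) (‖z - w‖ ^ 2) using 5 with t
      · simp
        abel
      · simp)
  have : ‖x - y‖ = 0 := by simpa using h
  exact hxy (sub_eq_zero.1 (norm_eq_zero.1 this))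

/-- Parallel vectors have vanishing 2 × 2 minors. In the minor of coordinates i ≠ j, moving x along
the j-th axis has rate (w - z) i, and i is chosen to make this nonzero. -/
lemma span_ne_span (hn : 2 ≤ n) {x y z w : EuclideanSpace ℝ (Fin n)} (hx : x ∈ E) (hy : y ∈ E)
    (hz : z ∈ E) (hw : w ∈ E) (hxy : x ≠ y) (hxz : x ≠ z) (hxw : x ≠ w) (hzw : z ≠ w) :
    Submodule.span ℝ {y - x} ≠ Submodule.span ℝ {w - z} := by
  intro hs
  obtain ⟨c, hc⟩ := Submodule.mem_span_singleton.1
    (hs ▸ Submodule.mem_span_singleton_self (y - x) : y - x ∈ Submodule.span ℝ {w - z})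
  obtain ⟨i, hi⟩ : ∃ i, (w - z) i ≠ 0 := by
    by_contra! h
    exact hzw (sub_eq_zero.1 (PiLp.ext h)).symm
  have : Nontrivial (Fin n) := Fin.nontrivial_iff_two_le.2 hn
  obtain ⟨j, hj⟩ := exists_ne i
  have h := hasDerivAt_eq_zero_of_apply_eq_zero hE hN hN0 hδ hσ (u := ![x, y, z, w]) (i₀ := 0)
    (G := fun b => (b 1 i - b 0 i) * (b 3 j - b 2 j) - (b 1 j - b 0 j) * (b 3 i - b 2 i))
    (by intro j; fin_cases j <;> simpa) (by intro j hj; fin_cases j <;> simp_all [eq_comm])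
    (by fun_prop)
    (by
      refine .of_forall fun k b hb => ?_
      choose f hf using hb
      refine ⟨(f 1 i - f 0 i) * (f 3 j - f 2 j) - (f 1 j - f 0 j) * (f 3 i - f 2 i), ?_⟩
      push_cast
      simp only [← hf]
      ring)
    (by
      have h1 : ∀ i, y i - x i = c * (w i - z i) := fun i => by
        simpa using congrArg (fun v : EuclideanSpace ℝ (Fin n) => v i) hc.symm
      simp [h1]
      ring) (EuclideanSpace.single j 1) (l := (w - z) i)
    (by
      have h1 : ∀ i, y i - x i = c * (w i - z i) := fun i => by
        simpa using congrArg (fun v : EuclideanSpace ℝ (Fin n) => v i) hc.symm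
      refine (hasDerivAt_mul_const ((w - z) i)).congr_of_eventuallyEq (.of_forall fun t => ?_)
      have h2 := h1 i
      have h3 := h1 j
      simp [hj.symm]
      linear_combination (w j - z j) * h2 - (w i - z i) * h3)
  exact hi h

end Consequences

/-! ### The distance set -/

lemma volume_sq_dist_eq_zero (hE : NearTranslatedLattices N δ σ E) (hN0 : ∀ k, 0 < N k)
    (hσ : ∃ᶠ k in atTop, σ k = 0) (hE1 : ∀ x ∈ E, ‖x‖ ≤ 1) :
    volume {r : ℝ | ∃ x ∈ E, ∃ y ∈ E, dist x y ^ 2 = r} = 0 := by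
  set F : Filter ℕ := atTop ⊓ 𝓟 {k | σ k = 0} with hF
  have : F.NeBot := frequently_mem_iff_neBot.1 hσ
  have hFσ : ∀ᶠ k in F, σ k = 0 := mem_inf_of_right (mem_principal_self _)
  have hlim : Tendsto (fun k : ℕ => ENNReal.ofReal (408 * (1 / ((k : ℝ) + 1)))) F (𝓝 0) := by
    have := (tendsto_one_div_add_atTop_nhds_zero_nat (𝕜 := ℝ)).const_mul 408
    simpa using (ENNReal.tendsto_ofReal this).mono_left inf_le_left
  refine le_antisymm (ge_of_tendsto hlim ?_) zero_le
  filter_upwards [hFσ] with k hk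
  have hNk : (1 : ℝ) ≤ (N k : ℝ) ^ 2 := one_le_pow₀ (by exact_mod_cast hN0 k)
  set η : ℝ := (((k : ℝ) + 1) * (N k : ℝ) ^ 2)⁻¹ with hη
  have hη0 : 0 < η := by positivity
  have hη1 : η ≤ 1 := by
    refine inv_le_one_of_one_le₀ ?_
    nlinarith [(Nat.cast_nonneg k : (0 : ℝ) ≤ k)]
  -- For lattice points a, b within η of x, y: | |a - b| ^ 2 - |x - y| ^ 2 | ≤ 2η (4 + 2η) ≤ 12η,
  -- and |a - b| ≤ 4 leaves at most 16 N ^ 2 + 1 values. The total length is at most 17 N ^ 2 · 24η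
  -- = 408 / (k + 1).
  have hcov : {r : ℝ | ∃ x ∈ E, ∃ y ∈ E, dist x y ^ 2 = r} ⊆
      ⋃ m ∈ Finset.range (16 * N k ^ 2 + 1), Metric.closedBall ((m : ℝ) / N k ^ 2) (12 * η) := by
    rintro _ ⟨x, hx, y, hy, rfl⟩
    obtain ⟨p, a, -, ha, hxa⟩ := hE x hx k
    obtain ⟨q, b, -, hb, hyb⟩ := hE y hy k
    simp only [hk, Pi.zero_apply, smul_zero, add_zero] at hxa hyb
    have hxy : dist x y ≤ 2 := by
      linarith [dist_le_norm_add_norm x y, hE1 x hx, hE1 y hy]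
    have h1 : dist x y ≤ dist a b + 2 * η := by
      linarith [dist_triangle4 x a b y, dist_comm b y]
    have h2 : dist a b ≤ dist x y + 2 * η := by
      linarith [dist_triangle4 a x y b, dist_comm a x]
    have h3 : (0 : ℝ) ≤ dist x y := dist_nonneg
    have h4 : (0 : ℝ) ≤ dist a b := dist_nonneg
    obtain ⟨z, hz⟩ := ha.exists_norm_sub_sq hb
    rw [← dist_eq_norm] at hz
    have hz0 : 0 ≤ z := by
      have : (0 : ℝ) ≤ z := by rw [← hz]; positivity
      exact_mod_cast this
    lift z to ℕ using hz0
    rw [Int.cast_natCast] at hz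
    have hz1 : z ≤ 16 * N k ^ 2 := by
      have : (z : ℝ) ≤ 16 * N k ^ 2 := by
        rw [← hz]
        gcongr
        nlinarith
      exact_mod_cast this
    refine Set.mem_iUnion₂.2 ⟨z, Finset.mem_range.2 (by lia), ?_⟩
    rw [Metric.mem_closedBall, Real.dist_eq, ← hz, mul_div_cancel_right₀ _ (by positivity), abs_le]
    constructor <;> nlinarith
  refine (measure_mono hcov).trans ((measure_biUnion_finset_le _ _).trans ?_)
  simp only [Real.volume_closedBall, Finset.sum_const, Finset.card_range, nsmul_eq_mul]
  rw [← ENNReal.ofReal_natCast, ← ENNReal.ofReal_mul (by positivity)]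
  refine ENNReal.ofReal_le_ofReal ?_
  push_cast
  have e : (N k : ℝ) ^ 2 * η = 1 / ((k : ℝ) + 1) := by
    have : (N k : ℝ) ≠ 0 := by exact_mod_cast (hN0 k).ne'
    rw [hη]; field_simp
  rw [← e]
  nlinarith

/-- The square root is differentiable away from 0, hence maps null sets there to null sets. -/
lemma volume_distanceSet_eq_zero
    (h : volume {r : ℝ | ∃ x ∈ E, ∃ y ∈ E, dist x y ^ 2 = r} = 0) :
    volume (distanceSet E) = 0 := by
  set S := {r : ℝ | ∃ x ∈ E, ∃ y ∈ E, dist x y ^ 2 = r} with hS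
  have hsub : distanceSet E ⊆ {0} ∪ Real.sqrt '' (S \ {0}) := by
    rintro _ ⟨x, hx, y, hy, rfl⟩
    by_cases hd : dist x y = 0
    · exact .inl hd
    · exact .inr ⟨dist x y ^ 2, ⟨⟨x, hx, y, hy, rfl⟩, by simpa using hd⟩, Real.sqrt_sq dist_nonneg⟩
  refine measure_mono_null hsub (measure_union_null (by simp) ?_)
  refine addHaar_image_eq_zero_of_differentiableOn_of_addHaar_eq_zero volume (fun r hr => ?_)
    (measure_mono_null Set.sdiff_subset h)
  exact (differentiableAt_id.sqrt hr.2).differentiableWithinAt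

end Avoidance

/-! ### Recurring translation fields -/

lemma exists_frequently_eq (α : Type*) [Countable α] [Nonempty α] :
    ∃ f : ℕ → α, ∀ a, ∃ᶠ k in atTop, f k = a := by
  obtain ⟨g, hg⟩ := exists_surjective_nat α
  refine ⟨fun k => g (Nat.unpair k).1, fun a => frequently_atTop.2 fun b => ?_⟩
  obtain ⟨m, rfl⟩ := hg a
  exact ⟨Nat.pair m b, Nat.right_le_pair m b, by simp⟩

/-- There is a sequence of bounded vector fields that contains infinitely often the zero field and
each field that is constant on a basic open set, with value in a dense set, and zero outside. -/
lemma exists_translations (n : ℕ) :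
    ∃ (σ : ℕ → EuclideanSpace ℝ (Fin n) → EuclideanSpace ℝ (Fin n)) (B : ℕ → ℕ),
      (∀ k x i, |σ k x i| ≤ B k) ∧ (∃ᶠ k in atTop, σ k = 0) ∧
      ∀ U ∈ countableBasis (EuclideanSpace ℝ (Fin n)), ∀ j, ∃ᶠ k in atTop,
        σ k = U.indicator fun _ => denseSeq (EuclideanSpace ℝ (Fin n)) j := by
  obtain ⟨f, hf⟩ := exists_frequently_eq (Option (countableBasis (EuclideanSpace ℝ (Fin n)) × ℕ))
  let field : Option (countableBasis (EuclideanSpace ℝ (Fin n)) × ℕ) →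
      EuclideanSpace ℝ (Fin n) → EuclideanSpace ℝ (Fin n) := fun T =>
    T.elim 0 fun T => (T.1 : Set (EuclideanSpace ℝ (Fin n))).indicator fun _ => denseSeq _ T.2
  have hbound : ∀ T, ∃ b : ℕ, ∀ x i, |field T x i| ≤ b := by
    rintro (_ | ⟨U, j⟩)
    · exact ⟨0, fun x i => by simp [field]⟩
    · obtain ⟨b, hb⟩ := exists_nat_ge ‖denseSeq (EuclideanSpace ℝ (Fin n)) j‖
      refine ⟨b, fun x i => ?_⟩
      have h1 : ‖field (some (U, j)) x i‖ ≤ ‖field (some (U, j)) x‖ := PiLp.norm_apply_le _ i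
      have h2 : ‖field (some (U, j)) x‖ ≤ ‖denseSeq (EuclideanSpace ℝ (Fin n)) j‖ :=
        norm_indicator_le_norm_self (fun _ => denseSeq (EuclideanSpace ℝ (Fin n)) j) x
      rw [← Real.norm_eq_abs]
      exact h1.trans (h2.trans hb)
  choose b hb using hbound
  refine ⟨fun k => field (f k), fun k => b (f k), fun k => hb (f k), ?_, fun U hU j => ?_⟩
  · exact (hf none).mono fun k hk => by simp only [hk]; rfl
  · exact (hf (some (⟨U, hU⟩, j))).mono fun k hk => by simp only [hk]; rfl

/-- If two pairs differ, some point of the first is not in the second; by symmetry it may be called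
x. -/
lemma distancesRealisedAtMostOnce_of_ne {X : Type*} [PseudoMetricSpace X] {E : Set X}
    (h : ∀ x ∈ E, ∀ y ∈ E, ∀ z ∈ E, ∀ w ∈ E, x ≠ y → x ≠ z → x ≠ w → dist x y ≠ dist z w) :
    DistancesRealisedAtMostOnce E := by
  intro x hx y hy z hz w hw hxy hzw hd
  by_contra hne
  rw [Sym2.eq_iff] at hne
  by_cases hxm : x = z ∨ x = w
  · refine h y hy x hx z hz w hw hxy.symm ?_ ?_ (by rwa [dist_comm]) <;> grind
  · push Not at hxm
    exact h x hx y hy z hz w hw hxy hxm.1 hxm.2 hd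

lemma directionsRealisedAtMostOnce_of_ne {V : Type*} [AddCommGroup V] [Module ℝ V] {E : Set V}
    (h : ∀ x ∈ E, ∀ y ∈ E, ∀ z ∈ E, ∀ w ∈ E, x ≠ y → x ≠ z → x ≠ w → z ≠ w →
      Submodule.span ℝ {y - x} ≠ Submodule.span ℝ {w - z}) :
    DirectionsRealisedAtMostOnce E := by
  intro x hx y hy z hz w hw hxy hzw hd
  by_contra hne
  rw [Sym2.eq_iff] at hne
  by_cases hxm : x = z ∨ x = w
  · have hd' : Submodule.span ℝ {x - y} = Submodule.span ℝ {w - z} := by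
      rw [← hd, ← neg_sub, ← Set.neg_singleton, Submodule.span_neg]
    refine h y hy x hx z hz w hw hxy.symm ?_ ?_ hzw hd' <;> grind
  · push Not at hxm
    exact h x hx y hy z hz w hw hxy hxm.1 hxm.2 hzw hd

/-- In a collinear triple the different pairs {x, y} and {x, z} have the same direction. -/
lemma DirectionsRealisedAtMostOnce.not_collinear {V : Type*} [AddCommGroup V] [Module ℝ V]
    {E : Set V} (h : DirectionsRealisedAtMostOnce E) {x y z : V} (hx : x ∈ E) (hy : y ∈ E)
    (hz : z ∈ E) (hxy : x ≠ y) (hyz : y ≠ z) (hxz : x ≠ z) :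
    ¬ Collinear ℝ ({x, y, z} : Set V) := by
  intro hc
  obtain ⟨v, hv⟩ := (collinear_iff_of_mem (p₀ := x) (by simp)).1 hc
  obtain ⟨r, hr⟩ := hv y (by simp)
  obtain ⟨s, hs⟩ := hv z (by simp)
  have hspan : ∀ (t : ℝ) (u : V), u ≠ x → u = t • v +ᵥ x →
      Submodule.span ℝ {u - x} = Submodule.span ℝ {v} := by
    rintro t u hu rfl
    have ht : t ≠ 0 := by
      rintro rfl
      simp at hu
    simpa using Submodule.span_singleton_smul_eq (IsUnit.mk0 t ht) v
  have := h x hx y hy x hx z hz hxy hxz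
    ((hspan r y hxy.symm hr).trans (hspan s z hxz.symm hs).symm)
  rw [Sym2.eq_iff] at this
  grind

theorem theorem5p3 (n : ℕ) (hn : 2 ≤ n) :
    ∃ E : Set (EuclideanSpace ℝ (Fin n)),
      IsCompact E ∧
      dimH E = (n : ENNReal) / 2 ∧
      MeasureTheory.volume (distanceSet E) = 0 ∧
      (∀ x ∈ E, ∀ y ∈ E, x ≠ y → Irrational (dist x y)) ∧
      (∀ x ∈ E, ∀ y ∈ E, ∀ z ∈ E, x ≠ y → y ≠ z → x ≠ z →
        ¬ Collinear ℝ ({x, y, z} : Set (EuclideanSpace ℝ (Fin n)))) ∧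
      DistancesRealisedAtMostOnce E ∧
      DirectionsRealisedAtMostOnce E := by
  have hn0 : 0 < n := by lia
  obtain ⟨σ, B, hB, hσ0, hσ⟩ := exists_translations n
  have hE : NearTranslatedLattices (mesh n B) (fun k => (invRadius n B k : ℝ)⁻¹) σ
      (latticeCantor B σ) := fun x hx k => exists_lattice_approx hn0 hB hx k
  have hN0 : ∀ k, 0 < mesh n B k := mesh_pos hn0
  have hN : Tendsto (mesh n B) atTop atTop :=
    tendsto_atTop_mono (fun k => (Nat.self_le_factorial k).trans
      (Nat.le_of_dvd (hN0 k) (factorial_dvd_mesh k))) tendsto_id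
  have hδ := tendsto_inv_invRadius (B := B) hn0
  have hdir : DirectionsRealisedAtMostOnce (latticeCantor B σ) :=
    directionsRealisedAtMostOnce_of_ne fun x hx y hy z hz w hw =>
      span_ne_span hE hN hN0 hδ hσ hn hx hy hz hw
  exact ⟨latticeCantor B σ, isCompact_latticeCantor, dimH_latticeCantor hn0 hB,
    volume_distanceSet_eq_zero (volume_sq_dist_eq_zero hE hN0 hσ0 norm_le_one_of_mem),
    fun x hx y hy => irrational_dist hE hN hN0 hδ hσ factorial_dvd_mesh hx hy,
    fun x hx y hy z hz => hdir.not_collinear hx hy hz,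
    distancesRealisedAtMostOnce_of_ne fun x hx y hy z hz w hw =>
      dist_ne_dist hE hN hN0 hδ hσ hx hy hz hw, hdir⟩
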